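/- **Automata.** Let $k\ge 1$. A one-way nondeterministic $k$-head finite automaton is a system $M=\langle S,A,k,\delta,\vartriangleright,\vartriangleleft,s_0,F\rangle$ with a finite set $S$ of states, a finite input alphabet $A$, endmarkers $\vartriangleright,\vartriangleleft\notin A$, an initial state $s_0\in S$, a set $F\subseteq S$ of accepting states, and a partial transition function $\delta$ from $S\times(A\cup\{\vartriangleright,\vartriangleleft\})^k$ to the subsets of $S\times\{0,1\}^k$, such that no head that scans $\vartriangleleft$ is moved to the right. On input $w\in A^*$ the tape holds $\vartriangleright w\vartriangleleft$ on squares $0,\dots,|w|+1$; $M$ starts in state $s_0$ with all $k$ heads on square $1$. If $M$ is in state $s$ and its heads scan $a_1,\dots,a_k$, it may, for any $(s',(d_1,\dots,d_k))\in\delta(s,(a_1,\dots,a_k))$, enter state $s'$ and move head $i$ by $d_i$ squares to the right, $1\le i\le k$; it halts when $\delta$ is undefined for the current situation. The language $L(M)$ is the set of all $w\in A^*$ on which some computation halts in an accepting state. $M$ is deterministic if every defined value of $\delta$ is a singleton. Write $\mathrm{1DFA}(k)$ and $\mathrm{1NFA}(k)$ for the classes of deterministic and of nondeterministic one-way $k$-head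 finite automata; automata are identified with finite descriptions of them (state sets being $\{0,\dots,n-1\}$ with $n\ge 1$, alphabets $\{0,\dots,m-1\}$), so that it makes sense to compute with them. Languages are taken together with their alphabet; for a class $E$ and a language $L$ over $A$, let $E(L)$ be the set of $M\in E$ with input alphabet $A$ and $L(M)=L$. **Complexity measures.** A complexity measure for $E$ is a total recursive function $c:E\to\mathbb N$ such that, for every alphabet $A$, the set of automata in $E$ with input alphabet $A$ is recursively enumerable in order of increasing size $c$ and does not contain infinitely many automata of the same size. **Statement.** Let $k\ge 2$. Then the trade-off between $\mathrm{1DFA}(k)$ and $\mathrm{1NFA}(1)$ is non-recursive. That is: let $c$ be any complexity measure for both $\mathrm{1DFA}(k)$ and $\mathrm{1NFA}(1)$. Then there is no recursive function $f:\mathbb N\to\mathbb N$ with $f(n)\ge n$ for all $n$ such that, for all languages $L$ that are accepted both by some automaton in $\mathrm{1DFA}(k)$ and by some automaton in $\mathrm{1NFA}(1)$ with the same alphabet, $$\min\{c(D)\mid D\in \mathrm{1NFA}(1)(L)\}\le f\bigl(\min\{c(D)\mid D\in \mathrm{1DFA}(k)(L)\}\bigr).$$ -/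

import Mathlib

/-- The contents of a tape square: an endmarker or one of the `m` input symbols. -/
inductive TapeSymbol (m : ℕ) where
  | leftEnd
  | rightEnd
  | letter (a : Fin m)

/-- The symbol at position `p` of the tape that holds the word `w` between two endmarkers: the left
endmarker is at position `0`, the letters of `w` are at `1, …, |w|`, and the right endmarker is at
position `|w| + 1`. -/
def tapeAt {m : ℕ} (w : List (Fin m)) : ℕ → TapeSymbol m
  | 0 => .leftEnd
  | p + 1 => if h : p < w.length then .letter w[p] else .rightEnd

/-- A (two-way, nondeterministic) multi-head finite automaton over the alphabet `Fin m` with state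
set `Fin states`. The transition function is partial: `none` means undefined. A move in
`SignType = {-1, 0, 1}` is the displacement of a head. -/
structure MultiheadAutomaton (m : ℕ) where
  heads : ℕ
  heads_pos : 1 ≤ heads
  states : ℕ
  start : Fin states
  accept : Finset (Fin states)
  trans : Fin states → (Fin heads → TapeSymbol m) →
    Option (Finset (Fin states × (Fin heads → SignType)))
  left_le : ∀ s a T, trans s a = some T → ∀ t ∈ T, ∀ i, a i = .leftEnd → t.2 i ≠ -1
  le_right : ∀ s a T, trans s a = some T → ∀ t ∈ T, ∀ i, a i = .rightEnd → t.2 i ≠ 1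

/-- The type of the finite strings of data by which automata are given to an algorithm. -/
abbrev AutomatonCode : Type :=
  ℕ × ℕ × ℕ × ℕ × List Bool × List (List (Option (List (List Bool))))

/-- The numbering of the tape symbols that is used in codes. -/
def symbolOf {m : ℕ} : Fin (m + 2) → TapeSymbol m :=
  Fin.cases .leftEnd (Fin.cases .rightEnd .letter)

/-- The numbering of the moves that is used in codes. -/
def moveOf : Fin 3 → SignType := ![-1, 0, 1]

theorem symbolOf_surjective {m : ℕ} : Function.Surjective (symbolOf (m := m)) := by
  rintro (_ | _ | a)
  · exact ⟨0, rfl⟩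
  · exact ⟨Fin.succ 0, rfl⟩
  · exact ⟨a.succ.succ, rfl⟩

theorem moveOf_surjective : Function.Surjective moveOf := by decide

namespace MultiheadAutomaton

variable {m : ℕ}

/-- A configuration on input `w`: the current state and the positions of the heads. -/
abbrev Config (M : MultiheadAutomaton m) (w : List (Fin m)) : Type :=
  Fin M.states × (Fin M.heads → Fin (w.length + 2))

/-- The initial configuration: all heads are at position `1`. -/
def init (M : MultiheadAutomaton m) (w : List (Fin m)) : M.Config w :=
  (M.start, fun _ => ⟨1, by omega⟩)

/-- The value of the transition function in a configuration. -/
def options (M : MultiheadAutomaton m) (w : List (Fin m)) (C : M.Config w) :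
    Option (Finset (Fin M.states × (Fin M.heads → SignType))) :=
  M.trans C.1 fun i => tapeAt w (C.2 i)

/-- One step of a computation. -/
def Step (M : MultiheadAutomaton m) (w : List (Fin m)) (C C' : M.Config w) : Prop :=
  ∃ T, M.options w C = some T ∧ ∃ t ∈ T, C'.1 = t.1 ∧
    ∀ i, (((C'.2 i : ℕ) : ℤ)) = ((C.2 i : ℕ) : ℤ) + ((t.2 i : SignType) : ℤ)

/-- The machine halts where its transition function is undefined. -/
def Halts (M : MultiheadAutomaton m) (w : List (Fin m)) (C : M.Config w) : Prop :=
  M.options w C = none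

/-- The words for which some computation halts in an accepting state. -/
def language (M : MultiheadAutomaton m) : Language (Fin m) :=
  {w | ∃ C : M.Config w,
    Relation.ReflTransGen (M.Step w) (M.init w) C ∧ C.1 ∈ M.accept ∧ M.Halts w C}

/-- The transition function has no value with more or less than one element. -/
def IsDeterministic (M : MultiheadAutomaton m) : Prop :=
  ∀ s a T, M.trans s a = some T → ∃ t, T = {t}

/-- No head ever moves to the left. -/
def IsOneWay (M : MultiheadAutomaton m) : Prop :=
  ∀ s a T, M.trans s a = some T → ∀ t ∈ T, ∀ i, t.2 i ≠ -1

/-- The full description of an automaton as a finite object: the sizes of the alphabet and of the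
state set, the number of heads, the initial state, the characteristic vector of the accepting
states, and the table of the transition function. In the table, the `k`-tuples of symbols and of
moves are listed as the `k`-digit numbers in base `m + 2` and in base `3`. -/
def code (M : MultiheadAutomaton m) : AutomatonCode :=
  (m, M.heads, M.states, M.start,
    List.ofFn fun s => decide (s ∈ M.accept),
    List.ofFn fun s => List.ofFn fun a : Fin ((m + 2) ^ M.heads) =>
      (M.trans s fun i => symbolOf (finFunctionFinEquiv.symm a i)).map fun T =>
        List.ofFn fun s' => List.ofFn fun d : Fin (3 ^ M.heads) =>
          decide ((s', fun i => moveOf (finFunctionFinEquiv.symm d i)) ∈ T))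

/-- An automaton is determined by its code. -/
theorem code_injective : Function.Injective (code (m := m)) := by
  rintro ⟨k, hk, n, s₀, F, δ, h₁, h₂⟩ ⟨k', hk', n', s₀', F', δ', h₁', h₂'⟩ h
  simp only [code, Prod.mk.injEq] at h
  obtain ⟨-, rfl, rfl, h0, hF, hδ⟩ := h
  obtain rfl : s₀ = s₀' := Fin.ext h0
  obtain rfl : F = F' := by
    ext s
    simpa using congrFun (List.ofFn_injective hF) s
  obtain rfl : δ = δ' := by
    funext s a
    choose b hb using fun i => symbolOf_surjective (a i)
    have h := congrFun (List.ofFn_injective (congrFun (List.ofFn_injective hδ) s))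
      (finFunctionFinEquiv b)
    simp only [Equiv.symm_apply_apply, hb] at h
    refine Option.map_injective (fun T T' hT => ?_) h
    ext ⟨s', d⟩
    choose e he using fun i => moveOf_surjective (d i)
    have h := congrFun (List.ofFn_injective (congrFun (List.ofFn_injective hT) s'))
      (finFunctionFinEquiv e)
    simpa only [Equiv.symm_apply_apply, he, decide_eq_decide] using h
  rfl

end MultiheadAutomaton

/-- A class of multi-head automata: for every `m`, the members with alphabet `Fin m`. -/
abbrev AutomatonClass : Type := (m : ℕ) → Set (MultiheadAutomaton m)

/-- One-way deterministic `k`-head finite automata. -/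
def oneWayDeterministic (k : ℕ) : AutomatonClass := fun _ =>
  {M | M.heads = k ∧ M.IsOneWay ∧ M.IsDeterministic}

/-- One-way nondeterministic `k`-head finite automata. -/
def oneWayNondeterministic (k : ℕ) : AutomatonClass := fun _ =>
  {M | M.heads = k ∧ M.IsOneWay}

/-- `c` is a complexity (size) measure for the class `E`: it is total recursive on `E`, and for every
alphabet the members of `E` over it are recursively enumerable in order of increasing size (the
enumeration may pause, which is the value `none`), only finitely many of them having the same
size. -/
structure IsComplexityMeasure (E : AutomatonClass) (c : (m : ℕ) → MultiheadAutomaton m → ℕ) :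
    Prop where
  recursive : ∃ g : AutomatonCode →. ℕ, Partrec g ∧ ∀ m, ∀ M ∈ E m, c m M ∈ g M.code
  enumerable : ∀ m, ∃ e : ℕ → Option (MultiheadAutomaton m),
    Computable (fun i => (e i).map MultiheadAutomaton.code) ∧
    (∀ M, M ∈ E m ↔ ∃ i, e i = some M) ∧
    ∀ i j M M', i ≤ j → e i = some M → e j = some M' → c m M ≤ c m M'
  finite : ∀ m n, {M | M ∈ E m ∧ c m M = n}.Finite

/-- The members of `E` that describe the language `L` over the alphabet `Fin m`. -/
def descriptors (E : AutomatonClass) {m : ℕ} (L : Language (Fin m)) : Set (MultiheadAutomaton m) :=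
  {M | M ∈ E m ∧ M.language = L}

/-- The size of a smallest description of `L` in `E` (used only where there is one). -/
noncomputable def minSize (E : AutomatonClass) (c : (m : ℕ) → MultiheadAutomaton m → ℕ) {m : ℕ}
    (L : Language (Fin m)) : ℕ :=
  sInf (c m '' descriptors E L)

/-- `f` bounds the increase in complexity when changing from a minimal description in `E₁` to an
equivalent minimal description in `E₂`. -/
def IsUpperBound (E₁ E₂ : AutomatonClass) (c : (m : ℕ) → MultiheadAutomaton m → ℕ) (f : ℕ → ℕ) :
    Prop :=
  (∀ n, n ≤ f n) ∧ ∀ (m : ℕ) (L : Language (Fin m)),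
    (descriptors E₁ L).Nonempty → (descriptors E₂ L).Nonempty →
      minSize E₂ c L ≤ f (minSize E₁ c L)

/-- There is no recursive upper bound for the trade-off between `E₁` and `E₂`. -/
def IsNonRecursiveTradeoff (E₁ E₂ : AutomatonClass) (c : (m : ℕ) → MultiheadAutomaton m → ℕ) :
    Prop :=
  ¬ ∃ f : ℕ → ℕ, Computable f ∧ IsUpperBound E₁ E₂ c f

/-! A halting computation of a queue machine can be coded in a word that two one-way heads check
deterministically, while one head can single that word out only with many states. Let T be the word
of all letters that are ever in the queue, in order of arrival. One head follows the front of the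
queue and one its back: a pop reads a letter with the front head, a push is checked against the
letter at the back head. If the machine halts, this automaton accepts exactly T, and the machine
makes at most 2|T| steps, since every step other than the halt moves one of the two heads across a
letter of T (`exists_language_historyAutomaton_eq`). Conversely, a one-way one-head automaton with n
states that accepts only T satisfies |T| < 2^n: otherwise two suffixes of T are accepted from the
same states, and exchanging them yields a shorter accepted word
(`length_lt_of_language_eq_singleton`).

Given a recursive bound f, the size of the history automaton is computable from the input
(`primrec_code_historyAutomaton`), f bounds the size of a smallest one-head automaton, and
`exists_computable_states_le` turns size into a number of states. This bounds |T|, hence the running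
time, so halting would be decidable, against `exists_queueMachine_not_computablePred`. That lemma
simulates the four-stack machines of `Turing.PartrecToTM2` by a queue that is rotated cyclically.
For inputs without halting, nothing about the automaton is needed. -/

namespace MultiheadAutomaton

/-! ### Acceptance along forced steps -/

variable {m : ℕ} (M : MultiheadAutomaton m) (w : List (Fin m))

/-- Some computation from the configuration `C` halts in an accepting state. -/
def AcceptsFrom (C : M.Config w) : Prop :=
  ∃ C' : M.Config w, Relation.ReflTransGen (M.Step w) C C' ∧ C'.1 ∈ M.accept ∧ M.Halts w C'

variable {M w}

theorem not_step_of_halts {C C' : M.Config w} (h : M.Halts w C) : ¬ M.Step w C C' := by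
  rintro ⟨T, hT, -⟩
  rw [Halts] at h
  simp [h] at hT

theorem acceptsFrom_of_halts {C : M.Config w} (h : M.Halts w C) :
    M.AcceptsFrom w C ↔ C.1 ∈ M.accept := by
  constructor
  · rintro ⟨C', hC', ha, -⟩
    rcases hC'.cases_head with rfl | ⟨C₁, hs, -⟩
    · exact ha
    · exact absurd hs (not_step_of_halts h)
  · exact fun ha => ⟨C, .refl, ha, h⟩

theorem acceptsFrom_of_step {C C₁ : M.Config w} (h : M.Step w C C₁)
    (hu : ∀ C', M.Step w C C' → C' = C₁) : M.AcceptsFrom w C ↔ M.AcceptsFrom w C₁ := by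
  constructor
  · rintro ⟨C', hC', ha, hh⟩
    rcases hC'.cases_head with rfl | ⟨C₂, hs, hr⟩
    · exact absurd h (not_step_of_halts hh)
    · exact ⟨C', hu C₂ hs ▸ hr, ha, hh⟩
  · rintro ⟨C', hC', ha, hh⟩
    exact ⟨C', .head h hC', ha, hh⟩

theorem step_iff_of_options {C C' : M.Config w} {t : Fin M.states × (Fin M.heads → SignType)}
    (h : M.options w C = some {t}) : M.Step w C C' ↔ C'.1 = t.1 ∧
      ∀ i, (((C'.2 i : ℕ) : ℤ)) = ((C.2 i : ℕ) : ℤ) + ((t.2 i : SignType) : ℤ) := by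
  simp only [Step, h, Option.some.injEq, exists_eq_left', Finset.mem_singleton, exists_eq_left]

/-- The way to reject in the constructions below: all their states are accepting, so a failed test
must prevent halting. -/
theorem not_acceptsFrom_of_loop {C : M.Config w} (h : M.options w C = some {(C.1, 0)}) :
    ¬ M.AcceptsFrom w C := by
  have key : ∀ C', M.Step w C C' → C' = C := by
    intro C' hs
    obtain ⟨h1, h2⟩ := (step_iff_of_options h).1 hs
    refine Prod.ext h1 (funext fun i => Fin.ext ?_)
    have := h2 i
    simp at this
    exact this
  rintro ⟨C', hC', -, hh⟩
  have : C' = C := by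
    clear hh
    induction hC' with
    | refl => rfl
    | tail _ hs ih => exact key _ (ih ▸ hs)
  rw [this, Halts, h] at hh
  cases hh

/-- A step that moves only the head `j` to the right, when it is the only one possible. -/
theorem exists_acceptsFrom_move {C : M.Config w} {s : Fin M.states} (j : Fin M.heads)
    (h : M.options w C = some {(s, fun i => if i = j then 1 else 0)})
    (hj : (C.2 j : ℕ) ≤ w.length) :
    ∃ C₁ : M.Config w, C₁.1 = s ∧ (C₁.2 j : ℕ) = C.2 j + 1 ∧ (∀ i, i ≠ j → C₁.2 i = C.2 i) ∧
      (M.AcceptsFrom w C ↔ M.AcceptsFrom w C₁) := by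
  refine ⟨(s, fun i => if i = j then ⟨C.2 j + 1, by omega⟩ else C.2 i), rfl, by simp,
    fun i hi => by simp [hi], acceptsFrom_of_step ?_ ?_⟩
  · rw [step_iff_of_options h]
    refine ⟨rfl, fun i => ?_⟩
    by_cases hi : i = j
    · subst hi; simp
    · simp [hi]
  · intro C' hs
    obtain ⟨h1, h2⟩ := (step_iff_of_options h).1 hs
    refine Prod.ext h1 (funext fun i => Fin.ext ?_)
    have := h2 i
    by_cases hi : i = j
    · subst hi; simp at this ⊢; omega
    · simpa [hi] using this

end MultiheadAutomaton

/-- The input letter in a tape square, if there is one. -/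
def TapeSymbol.letter? {m : ℕ} : TapeSymbol m → Option (Fin m)
  | .letter a => some a
  | _ => none

theorem letter?_tapeAt_succ {m : ℕ} (w : List (Fin m)) (p : ℕ) :
    (tapeAt w (p + 1)).letter? = w[p]? := by
  by_cases h : p < w.length <;> simp [tapeAt, h, TapeSymbol.letter?]

namespace MultiheadAutomaton

variable {m : ℕ}

/-! ### One-way automata with one head and a single word -/

/-- The symbol scanned by a head that has the word `z` in front of it. -/
def frontSymbol : List (Fin m) → TapeSymbol m
  | [] => .rightEnd
  | a :: _ => .letter a

theorem tapeAt_succ_eq_frontSymbol (w : List (Fin m)) (p : ℕ) :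
    tapeAt w (p + 1) = frontSymbol (w.drop p) := by
  by_cases h : p < w.length
  · rw [List.drop_eq_getElem_cons h]
    simp [tapeAt, h, frontSymbol]
  · rw [List.drop_eq_nil_of_le (by omega)]
    simp [tapeAt, h, frontSymbol]

/-- Acceptance of a word by a one-way automaton that starts in a given state, all heads being in
front of that word. -/
inductive AcceptsSuffix (M : MultiheadAutomaton m) : Fin M.states → List (Fin m) → Prop
  | halt {s z} : M.trans s (fun _ => frontSymbol z) = none → s ∈ M.accept → AcceptsSuffix M s z
  | stay {s z T t} : M.trans s (fun _ => frontSymbol z) = some T → t ∈ T → t.2 = 0 →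
      AcceptsSuffix M t.1 z → AcceptsSuffix M s z
  | move {s a z T t} : M.trans s (fun _ => .letter a) = some T → t ∈ T → t.2 = 1 →
      AcceptsSuffix M t.1 z → AcceptsSuffix M s (a :: z)

/-- As long as the head stays on `a`, the word behind it is not consulted; `h` takes over at the
first move. -/
theorem AcceptsSuffix.congr_cons {M : MultiheadAutomaton m} {z z' : List (Fin m)} {a : Fin m}
    (h : ∀ s, M.AcceptsSuffix s z → M.AcceptsSuffix s z') {s : Fin M.states}
    (hs : M.AcceptsSuffix s (a :: z)) : M.AcceptsSuffix s (a :: z') := by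
  generalize hy : a :: z = y at hs
  induction hs with
  | halt h1 h2 => subst hy; exact .halt h1 h2
  | stay h1 h2 h3 _ ih => subst hy; exact .stay h1 h2 h3 (ih rfl)
  | move h1 h2 h3 h4 _ => cases hy; exact .move h1 h2 h3 (h _ h4)

theorem AcceptsSuffix.congr_append {M : MultiheadAutomaton m} {z z' : List (Fin m)}
    (h : ∀ s, M.AcceptsSuffix s z → M.AcceptsSuffix s z') (u : List (Fin m)) (s : Fin M.states)
    (hs : M.AcceptsSuffix s (u ++ z)) : M.AcceptsSuffix s (u ++ z') := by
  induction u generalizing s with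
  | nil => exact h s hs
  | cons a u ih => exact AcceptsSuffix.congr_cons ih hs

/-- A single head that never moves left cannot see what it has passed, so acceptance depends on the
state and the remaining suffix only. -/
theorem acceptsSuffix_of_acceptsFrom {M : MultiheadAutomaton m} (h1 : M.heads = 1)
    (hM : M.IsOneWay) {w : List (Fin m)} {C : M.Config w} {p : ℕ} (hp : ∀ i, (C.2 i : ℕ) = p + 1)
    (h : M.AcceptsFrom w C) : M.AcceptsSuffix C.1 (w.drop p) := by
  have : Subsingleton (Fin M.heads) := by rw [h1]; infer_instance
  have opt : ∀ (C : M.Config w) (p : ℕ), (∀ i, (C.2 i : ℕ) = p + 1) →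
      M.options w C = M.trans C.1 fun _ => frontSymbol (w.drop p) := by
    intro C p hp
    simp only [options, hp, tapeAt_succ_eq_frontSymbol]
  obtain ⟨C', hr, ha, hh⟩ := h
  induction hr using Relation.ReflTransGen.head_induction_on generalizing p with
  | refl => exact .halt (by rw [← opt _ p hp]; exact hh) ha
  | @head C C₁ hs _ ih =>
    obtain ⟨T, hT, t, ht, hts, htp⟩ := hs
    rw [opt _ p hp] at hT
    let j : Fin M.heads := ⟨0, by omega⟩
    have hone := hM _ _ _ hT t ht j
    have hpj := htp j
    rw [hp] at hpj
    have hall : ∀ i, C₁.2 i = C₁.2 j := fun i => by rw [Subsingleton.elim i j]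
    rcases htj : t.2 j with _ | _ | _
    · have h0 : t.2 = 0 := funext fun i => by rw [Subsingleton.elim i j, htj]; rfl
      simp only [h0, Pi.zero_apply, SignType.coe_zero, add_zero, Nat.cast_inj] at hpj
      exact .stay hT ht h0 (hts ▸ ih (fun i => by rw [hall, hpj]))
    · exact absurd htj hone
    · have h0 : t.2 = 1 := funext fun i => by rw [Subsingleton.elim i j, htj]; rfl
      simp only [h0, Pi.one_apply, SignType.coe_one] at hpj
      have hpw : p < w.length := by have := (C₁.2 j).2; omega
      have hd := List.drop_eq_getElem_cons hpw
      rw [hd] at hT ⊢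
      exact .move hT ht h0 (hts ▸ ih (fun i => by rw [hall]; omega))

theorem acceptsFrom_of_acceptsSuffix {M : MultiheadAutomaton m} {w z : List (Fin m)}
    {s : Fin M.states} (h : M.AcceptsSuffix s z) {C : M.Config w} {p : ℕ} (hs : C.1 = s)
    (hp : ∀ i, (C.2 i : ℕ) = p + 1) (hz : w.drop p = z) : M.AcceptsFrom w C := by
  have opt : ∀ (C : M.Config w) (p : ℕ), (∀ i, (C.2 i : ℕ) = p + 1) →
      M.options w C = M.trans C.1 fun _ => frontSymbol (w.drop p) := by
    intro C p hp
    simp only [options, hp, tapeAt_succ_eq_frontSymbol]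
  induction h generalizing C p with
  | halt h1 h2 => exact ⟨C, .refl, hs ▸ h2, by rw [Halts, opt _ p hp, hz, hs, h1]⟩
  | @stay s z T t h1 h2 h3 _ ih =>
    obtain ⟨C', hr, h'⟩ := ih (C := (t.1, C.2)) rfl hp hz
    refine ⟨C', .head ⟨T, by rw [opt _ p hp, hz, hs, h1], t, h2, rfl, fun i => ?_⟩ hr, h'⟩
    simp [h3]
  | @move s a z T t h1 h2 h3 _ ih =>
    have hpw : p < w.length := by
      by_contra hc
      rw [List.drop_eq_nil_of_le (by omega)] at hz
      cases hz
    have hz' : w.drop (p + 1) = z := by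
      rw [← List.tail_drop, hz, List.tail_cons]
    obtain ⟨C', hr, h'⟩ := ih (C := (t.1, fun _ => ⟨p + 2, by omega⟩)) rfl (fun _ => rfl) hz'
    refine ⟨C', .head ⟨T, by rw [opt _ p hp, hz, hs]; exact h1, t, h2, rfl, fun i => ?_⟩ hr, h'⟩
    simp [h3, hp]
    ring

theorem mem_language_iff_acceptsSuffix {M : MultiheadAutomaton m} (h1 : M.heads = 1)
    (hM : M.IsOneWay) {w : List (Fin m)} : w ∈ M.language ↔ M.AcceptsSuffix M.start w :=
  ⟨fun h => acceptsSuffix_of_acceptsFrom h1 hM (p := 0) (fun _ => rfl) h,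
    fun h => acceptsFrom_of_acceptsSuffix h (p := 0) rfl (fun _ => rfl) rfl⟩

/-- A one-way one-head automaton with `n` states that accepts one word only, accepts a word of
length less than `2 ^ n`. -/
theorem length_lt_of_language_eq_singleton {M : MultiheadAutomaton m} (h1 : M.heads = 1)
    (hM : M.IsOneWay) {w : List (Fin m)} (hL : M.language = {w}) : w.length < 2 ^ M.states := by
  by_contra! hlen
  let R : Fin (w.length + 1) → Set (Fin M.states) := fun i => {s | M.AcceptsSuffix s (w.drop i)}
  -- Pigeonhole: there are |w| + 1 suffixes but only 2 ^ states sets of states.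
  have hR : ¬ Function.Injective R := fun hinj => by
    have := Fintype.card_le_of_injective R hinj
    simp at this
    omega
  obtain ⟨i, j, hij, hlt⟩ : ∃ i j, R i = R j ∧ i < j := by
    simp only [Function.Injective, not_forall] at hR
    obtain ⟨i, j, hij, hne⟩ := hR
    rcases lt_or_gt_of_ne hne with h | h
    · exact ⟨i, j, hij, h⟩
    · exact ⟨j, i, hij.symm, h⟩
  have hw : M.AcceptsSuffix M.start (w.take i ++ w.drop i) := by
    rw [List.take_append_drop, ← mem_language_iff_acceptsSuffix h1 hM, hL]
    rfl
  -- Cutting out the letters between positions `i` and `j` keeps the word accepted but shortens it.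
  have hw' := AcceptsSuffix.congr_append (fun s hs => (Set.ext_iff.1 hij s).1 hs) _ _ hw
  rw [← mem_language_iff_acceptsSuffix h1 hM, hL] at hw'
  have := congrArg List.length (Set.mem_singleton_iff.1 hw')
  simp at this
  omega

/-- The one-way automaton with one head that accepts the word `w` only. -/
def singletonAutomaton (w : List (Fin m)) : MultiheadAutomaton m where
  heads := 1
  heads_pos := le_rfl
  states := w.length + 1
  start := 0
  accept := Finset.univ
  trans s a :=
    -- In state |w| the right side is `none`, so the same test then asks for the right endmarker.
    if (a 0).letter? = w[(s : ℕ)]? then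
      if h : (s : ℕ) < w.length then some {(⟨s + 1, by omega⟩, 1)} else none
    else some {(s, 0)}
  left_le s a T h t ht i hi := by
    split_ifs at h <;> cases h <;> obtain rfl := Finset.mem_singleton.1 ht <;> simp
  le_right s a T h t ht i hi := by
    split_ifs at h with h1 h2
    · obtain rfl := Subsingleton.elim i 0
      simp [hi, TapeSymbol.letter?, h2] at h1
    · cases h
      obtain rfl := Finset.mem_singleton.1 ht
      simp

theorem isOneWay_singletonAutomaton (w : List (Fin m)) : (singletonAutomaton w).IsOneWay := by
  intro s a T h t ht i
  simp only [singletonAutomaton] at h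
  split_ifs at h <;> cases h <;> obtain rfl := Finset.mem_singleton.1 ht <;> simp

theorem options_singletonAutomaton (w v : List (Fin m)) (C : (singletonAutomaton w).Config v) :
    (singletonAutomaton w).options v C =
      if (tapeAt v (C.2 (⟨0, Nat.zero_lt_one⟩ : Fin (singletonAutomaton w).heads))).letter? =
          w[(C.1 : ℕ)]? then
        if h : (C.1 : ℕ) < w.length then some {(⟨C.1 + 1, Nat.succ_lt_succ h⟩, 1)} else none
      else some {(C.1, 0)} :=
  rfl

theorem language_singletonAutomaton (w : List (Fin m)) :
    (singletonAutomaton w).language = {w} := by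
  -- Invariant: in state `p` the first `p` letters agree with `w`; `n` counts the letters still to
  -- be compared.
  have key : ∀ n p, p + n = w.length → ∀ (v : List (Fin m)), w.take p <+: v →
      ∀ C : (singletonAutomaton w).Config v, (C.1 : ℕ) = p → (∀ i, (C.2 i : ℕ) = p + 1) →
      ((singletonAutomaton w).AcceptsFrom v C ↔ v = w) := by
    intro n
    induction n with
    | zero =>
      intro p hp v hv C hC hC2
      obtain rfl : p = w.length := by omega
      rw [List.take_length] at hv
      have hopt : (singletonAutomaton w).options v C =
          if v[w.length]? = none then none else some {(C.1, 0)} := by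
        rw [options_singletonAutomaton, hC2, letter?_tapeAt_succ]
        simp [hC]
      split_ifs at hopt with hif
      · rw [acceptsFrom_of_halts hopt]
        have : v = w := (hv.eq_of_length_le (by simpa using hif)).symm
        exact iff_of_true (Finset.mem_univ (α := Fin (w.length + 1)) _) this
      · refine iff_of_false (not_acceptsFrom_of_loop hopt) ?_
        rintro rfl
        simp at hif
    | succ n ih =>
      intro p hp v hv C hC hC2
      have hpw : p < w.length := by omega
      have hopt : (singletonAutomaton w).options v C =
          if v[p]? = some w[p] then some {(⟨p + 1, Nat.succ_lt_succ hpw⟩, fun i =>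
            if i = (⟨0, Nat.zero_lt_one⟩ : Fin (singletonAutomaton w).heads) then 1 else 0)}
          else some {(C.1, 0)} := by
        rw [options_singletonAutomaton, hC2, letter?_tapeAt_succ]
        have : (fun i => if i = (⟨0, Nat.zero_lt_one⟩ : Fin (singletonAutomaton w).heads) then
            (1 : SignType) else 0) = 1 :=
          funext fun i => if_pos (Subsingleton.elim (α := Fin 1) _ _)
        simp [hC, hpw, this]
      split_ifs at hopt with hif
      · have hpv : p < v.length := (List.getElem?_eq_some_iff.1 hif).1
        obtain ⟨C₁, h1, h2, -, h4⟩ := exists_acceptsFrom_move _ hopt (by rw [hC2]; omega)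
        rw [h4]
        refine ih (p + 1) (by omega) v ?_ C₁ (by rw [h1]) fun i => ?_
        · rw [List.prefix_iff_eq_take] at hv ⊢
          rw [List.length_take_of_le (by omega)] at hv ⊢
          rw [List.take_add_one, List.take_add_one, hv, hif]
          simp [hpw]
        · have : Subsingleton (Fin (singletonAutomaton w).heads) :=
            inferInstanceAs (Subsingleton (Fin 1))
          rw [Subsingleton.elim i ⟨0, Nat.zero_lt_one⟩, h2, hC2]
      · refine iff_of_false (not_acceptsFrom_of_loop hopt) ?_
        rintro rfl
        simp [hpw] at hif
  ext v
  exact key w.length 0 (by simp) v (by simp) _ rfl fun _ => rfl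

theorem singletonAutomaton_mem (w : List (Fin m)) :
    singletonAutomaton w ∈ descriptors (oneWayNondeterministic 1) {w} :=
  ⟨⟨rfl, isOneWay_singletonAutomaton w⟩, language_singletonAutomaton w⟩

end MultiheadAutomaton

/-! ### Queue machines -/

/-- An instruction of a queue machine with queue alphabet `Γ` and state set `Q`: append a letter to
the queue, remove the first letter of the queue and branch on it, or halt. -/
inductive QueueInstr (Γ Q : Type*) where
  | push (b : Γ) (q : Q)
  | pop (f : Γ → Q)
  | halt

section QueueMachine

variable {Γ Q : Type*}

/-- One step of a queue machine. A machine that has to read an empty queue waits forever. -/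
def queueStep (I : Q → QueueInstr Γ Q) (c : Q × List Γ) : Option (Q × List Γ) :=
  match I c.1, c.2 with
  | .push b q, l => some (q, l ++ [b])
  | .pop _, [] => some (c.1, [])
  | .pop f, a :: l => some (f a, l)
  | .halt, _ => none

/-- The queue machine, started in the configuration `c`, makes less than `n` steps and halts. -/
def HaltsWithin (I : Q → QueueInstr Γ Q) (n : ℕ) (c : Q × List Γ) : Prop :=
  (fun o : Option (Q × List Γ) => o.bind (queueStep I))^[n] (some c) = none

variable {I : Q → QueueInstr Γ Q}

theorem iterate_bind_none {α : Type*} (f : α → Option α) (n : ℕ) :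
    (fun o : Option α => o.bind f)^[n] none = none :=
  Function.iterate_fixed rfl n

theorem not_haltsWithin_zero {c : Q × List Γ} : ¬ HaltsWithin I 0 c := by
  simp [HaltsWithin]

theorem haltsWithin_succ_of_step {n : ℕ} {c c' : Q × List Γ} (h : queueStep I c = some c') :
    HaltsWithin I (n + 1) c ↔ HaltsWithin I n c' := by
  simp [HaltsWithin, h]

theorem haltsWithin_one {c : Q × List Γ} : HaltsWithin I 1 c ↔ queueStep I c = none := by
  simp [HaltsWithin]

theorem HaltsWithin.mono {n n' : ℕ} {c : Q × List Γ} (h : HaltsWithin I n c) (hn : n ≤ n') :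
    HaltsWithin I n' c := by
  obtain ⟨j, rfl⟩ := Nat.exists_eq_add_of_le hn
  rw [HaltsWithin] at h ⊢
  rw [Nat.add_comm, Function.iterate_add_apply, h, iterate_bind_none]

/-- Links step counts to `StateTransition.eval`, for which `StateTransition.tr_eval_dom` transfers
halting along a simulation. -/
theorem exists_haltsWithin_iff {c : Q × List Γ} :
    (∃ n, HaltsWithin I n c) ↔ (StateTransition.eval (queueStep I) c).Dom := by
  constructor
  · rintro ⟨n, hn⟩
    induction n generalizing c with
    | zero => exact absurd hn not_haltsWithin_zero
    | succ n ih =>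
      rcases hc : queueStep I c with _ | c'
      · exact Part.dom_iff_mem.2 ⟨c, StateTransition.mem_eval.2 ⟨.refl, hc⟩⟩
      · rw [StateTransition.reaches_eval (.single hc)]
        exact ih ((haltsWithin_succ_of_step hc).1 hn)
  · intro h
    obtain ⟨d, hd⟩ := Part.dom_iff_mem.1 h
    obtain ⟨hr, he⟩ := StateTransition.mem_eval.1 hd
    clear hd h
    induction hr using Relation.ReflTransGen.head_induction_on with
    | refl => exact ⟨1, haltsWithin_one.2 he⟩
    | head hs _ ih =>
      obtain ⟨n, hn⟩ := ih
      exact ⟨n + 1, (haltsWithin_succ_of_step hs).2 hn⟩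

/-- The behaviour of the history automaton in a state that stands for the state `q` of a queue
machine, when its heads at the front and at the back of the queue scan the letters `o₀` and `o₁`:
the next state, and which of the two heads is moved (`false`: the front). The automaton halts only
to accept; it rejects by repeating the configuration. -/
def historyMove [DecidableEq Γ] (I : Q → QueueInstr Γ Q) (q : Q) (o₀ o₁ : Option Γ) :
    Option (Q × Option Bool) :=
  match I q with
  | .push b q' => if o₁ = some b then some (q', some true) else some (q, none)
  | .pop f => o₀.elim (some (q, none)) fun a => some (f a, some false)
  | .halt => if o₁ = none then none else some (q, none)

end QueueMachine

/-! ### The history automaton -/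

namespace MultiheadAutomaton

variable {m : ℕ}

/-- The displacement of the heads when at most one of `h₀` and `h₁` is moved. -/
def headMove {k : ℕ} (h₀ h₁ : Fin k) : Option Bool → Fin k → SignType
  | none => 0
  | some b => fun i => if i = (if b then h₁ else h₀) then 1 else 0

theorem headMove_ne {k : ℕ} (h₀ h₁ : Fin k) (o : Option Bool) (i : Fin k) :
    headMove h₀ h₁ o i ≠ -1 := by
  rcases o with _ | b
  · simp [headMove]
  · simp only [headMove]
    split_ifs <;> decide

/-- The word of all letters that a halting queue machine ever has in its queue, is the only one that
is accepted by an automaton that checks this word with one head at the front and one head at the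
back of the queue. The length of the word bounds the number of steps of the queue machine. -/
theorem exists_acceptsFrom_iff_eq {M : MultiheadAutomaton m} (hacc : M.accept = Finset.univ)
    {h₀ h₁ : Fin M.heads} (hne : h₀ ≠ h₁) {Q : Type*} {I : Q → QueueInstr (Fin m) Q}
    (emb : Q → Fin M.states)
    (htrans : ∀ q a, M.trans (emb q) a = (historyMove I q (a h₀).letter? (a h₁).letter?).map
      fun r => {(emb r.1, headMove h₀ h₁ r.2)})
    (n : ℕ) (q : Q) (p l : List (Fin m)) (hn : HaltsWithin I n (q, l)) :
    ∃ T, (p ++ l) <+: T ∧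
      (∃ j, j + p.length + (p ++ l).length ≤ 2 * T.length + 1 ∧ HaltsWithin I j (q, l)) ∧
      ∀ w, (p ++ l) <+: w → ∀ C : M.Config w, C.1 = emb q → (C.2 h₀ : ℕ) = p.length + 1 →
        (C.2 h₁ : ℕ) = (p ++ l).length + 1 → (M.AcceptsFrom w C ↔ w = T) := by
  have hopt : ∀ {q : Q} {p l w : List (Fin m)} {C : M.Config w}, C.1 = emb q →
      (C.2 h₀ : ℕ) = p.length + 1 → (C.2 h₁ : ℕ) = (p ++ l).length + 1 → M.options w C =
        (historyMove I q w[p.length]? w[(p ++ l).length]?).map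
          fun r => {(emb r.1, headMove h₀ h₁ r.2)} := by
    intro q p l w C h1 h2 h3
    rw [options, h1, htrans]
    simp only [h2, h3, letter?_tapeAt_succ]
  -- Here `p` holds the letters already removed and `l` the present queue. A push lengthens `p ++ l`
  -- and a pop of a letter lengthens `p`, both by one and both bounded by |T|; this gives the
  -- inequality for `j`, the extra 1 being the halting step.
  induction n generalizing q p l with
  | zero => exact absurd hn not_haltsWithin_zero
  | succ n ih =>
    cases hq : I q with
    | halt =>
      refine ⟨p ++ l, List.prefix_rfl, ⟨1, ?_, haltsWithin_one.2 (by simp [queueStep, hq])⟩, ?_⟩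
      · simp
        omega
      · intro w hw C h1 h2 h3
        have ho := hopt h1 h2 h3
        simp only [historyMove, hq] at ho
        split_ifs at ho with hif
        · rw [acceptsFrom_of_halts ho, hacc]
          exact iff_of_true (Finset.mem_univ _)
            (hw.eq_of_length_le (List.getElem?_eq_none_iff.1 hif)).symm
        · refine iff_of_false (not_acceptsFrom_of_loop (by rw [h1]; exact ho)) ?_
          rintro rfl
          simp at hif
    | push b q' =>
      have hs : queueStep I (q, l) = some (q', l ++ [b]) := by simp [queueStep, hq]
      obtain ⟨T, hT, ⟨j, hj, hjh⟩, hw⟩ := ih q' p (l ++ [b]) ((haltsWithin_succ_of_step hs).1 hn)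
      have hTb : T[(p ++ l).length]? = some b := by
        obtain ⟨u, rfl⟩ := hT
        simp
      refine ⟨T, (List.prefix_append (p ++ l) [b]).trans (by simpa using hT),
        ⟨j + 1, ?_, (haltsWithin_succ_of_step hs).2 hjh⟩, ?_⟩
      · simp at hj ⊢
        omega
      · intro w hpw C h1 h2 h3
        have ho := hopt h1 h2 h3
        simp only [historyMove, hq] at ho
        split_ifs at ho with hif
        · obtain ⟨C₁, e1, e2, e3, e4⟩ := exists_acceptsFrom_move h₁ ho
            (by have := (List.getElem?_eq_some_iff.1 hif).1; omega)
          rw [e4]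
          refine hw w ?_ C₁ e1 (by rw [e3 _ hne, h2]) (by rw [e2, h3]; simp; omega)
          rw [← List.append_assoc]
          obtain ⟨u, rfl⟩ := hpw
          rw [List.getElem?_append_right le_rfl] at hif
          cases u with
          | nil => simp at hif
          | cons c u =>
            simp at hif
            simp [hif]
        · refine iff_of_false (not_acceptsFrom_of_loop (by rw [h1]; exact ho)) ?_
          rintro rfl
          exact hif hTb
    | pop f =>
      cases l with
      -- Waiting at an empty queue leaves the configuration unchanged, so the induction hypothesis
      -- is the claim itself.
      | nil => exact ih q p [] ((haltsWithin_succ_of_step (by simp [queueStep, hq])).1 hn)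
      | cons a l =>
        have hs : queueStep I (q, a :: l) = some (f a, l) := by simp [queueStep, hq]
        obtain ⟨T, hT, ⟨j, hj, hjh⟩, hw⟩ :=
          ih (f a) (p ++ [a]) l ((haltsWithin_succ_of_step hs).1 hn)
        refine ⟨T, by simpa using hT, ⟨j + 1, ?_, (haltsWithin_succ_of_step hs).2 hjh⟩, ?_⟩
        · simp at hj ⊢
          omega
        · intro w hpw C h1 h2 h3
          -- The front head reads inside the prefix already verified, so the move is forced and
          -- tests nothing.
          have hwa : w[p.length]? = some a := by
            obtain ⟨u, rfl⟩ := hpw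
            simp
          have ho := hopt h1 h2 h3
          simp only [historyMove, hq, hwa] at ho
          obtain ⟨C₁, e1, e2, e3, e4⟩ := exists_acceptsFrom_move h₀ ho
            (by have := (List.getElem?_eq_some_iff.1 hwa).1; omega)
          rw [e4]
          exact hw w (by simpa using hpw) C₁ e1 (by rw [e2, h2]; simp)
            (by rw [e3 _ hne.symm, h3]; simp)

/-- The transitions of the history automaton with natural numbers as states: first the letters of
`l` are checked, then the queue machine `I` is followed. -/
def historyTrans {n : ℕ} (I : Fin n → QueueInstr (Fin m) (Fin n)) (l : List (Fin m)) (s : ℕ)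
    (o₀ o₁ : Option (Fin m)) : Option (ℕ × Option Bool) :=
  (l[s]?).elim
    ((List.finRange n)[s - l.length]?.elim (some (s, none)) fun q =>
      (historyMove I q o₀ o₁).map fun r => (l.length + r.1, r.2))
    fun b => if o₁ = some b then some (s + 1, some true) else some (s, none)

/-- A moving head always scans a letter, hence never leaves the right endmarker; this yields
`le_right`. -/
theorem scanned_of_historyTrans {n : ℕ} {I : Fin n → QueueInstr (Fin m) (Fin n)}
    {l : List (Fin m)} {s : ℕ} {o₀ o₁ : Option (Fin m)} {t : ℕ} {b : Bool}
    (h : historyTrans I l s o₀ o₁ = some (t, some b)) : (if b then o₁ else o₀) ≠ none := by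
  unfold historyTrans at h
  rcases hl : l[s]? with _ | c
  · rw [hl, Option.elim_none] at h
    rcases hd : (List.finRange n)[s - l.length]? with _ | q
    · simp only [hd, Option.elim_none] at h
      simp at h
    · simp only [hd, Option.elim_some, historyMove] at h
      rcases hq : I q with ⟨c, q'⟩ | f | _
      · simp only [hq] at h
        split_ifs at h with hif
        · simp at h
          simp [← h.2, hif]
        · simp at h
      · rcases o₀ with _ | a
        · simp [hq] at h
        · simp [hq] at h
          simp [h.2]
      · simp only [hq] at h
        split_ifs at h <;> simp at h
  · rw [hl, Option.elim_some] at h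
    split_ifs at h with hif
    · simp at h
      simp [← h.2, hif]
    · simp at h

/-- The automaton that accepts the word of all letters that the queue machine `I`, started in state
`0` with the queue `l`, ever has in its queue. -/
def historyAutomaton {n : ℕ} (I : Fin (n + 1) → QueueInstr (Fin m) (Fin (n + 1)))
    (l : List (Fin m)) {k : ℕ} (h₀ h₁ : Fin k) : MultiheadAutomaton m where
  heads := k
  heads_pos := Nat.succ_le_of_lt h₀.pos
  states := l.length + (n + 1)
  start := ⟨0, by omega⟩
  accept := Finset.univ
  -- The remainder only produces an element of `Fin`: from a legal state the new state is already
  -- below the modulus.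
  trans s a := (historyTrans I l s (a h₀).letter? (a h₁).letter?).map fun r =>
    {(⟨r.1 % (l.length + (n + 1)), Nat.mod_lt _ (by omega)⟩, headMove h₀ h₁ r.2)}
  left_le s a T h t ht i hi := by
    obtain ⟨r, -, rfl⟩ := Option.map_eq_some_iff.1 h
    obtain rfl := Finset.mem_singleton.1 ht
    exact headMove_ne _ _ _ _
  le_right s a T h t ht i hi := by
    obtain ⟨⟨r, o⟩, hr, rfl⟩ := Option.map_eq_some_iff.1 h
    obtain rfl := Finset.mem_singleton.1 ht
    rcases o with _ | b
    · simp [headMove]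
    · have := scanned_of_historyTrans hr
      simp only [headMove]
      by_cases hij : i = if b then h₁ else h₀
      · subst hij
        cases b <;> simp_all [TapeSymbol.letter?]
      · rw [if_neg hij]
        decide

section

variable {n : ℕ} (I : Fin (n + 1) → QueueInstr (Fin m) (Fin (n + 1))) (l : List (Fin m)) {k : ℕ}
  (h₀ h₁ : Fin k)

theorem historyAutomaton_mem : historyAutomaton I l h₀ h₁ ∈ oneWayDeterministic k m := by
  refine ⟨rfl, fun s a T h t ht i => ?_, fun s a T h => ?_⟩ <;>
    obtain ⟨r, -, rfl⟩ := Option.map_eq_some_iff.1 h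
  · obtain rfl := Finset.mem_singleton.1 ht
    exact headMove_ne _ _ _ _
  · exact ⟨_, rfl⟩

variable {I l h₀ h₁}

theorem exists_language_historyAutomaton_eq (hne : h₀ ≠ h₁) {N : ℕ}
    (hN : HaltsWithin I N (0, l)) : ∃ T, (historyAutomaton I l h₀ h₁).language = {T} ∧
      HaltsWithin I (2 * T.length + 1) (0, l) := by
  obtain ⟨T, hT, ⟨j, hj, hjh⟩, hw⟩ := exists_acceptsFrom_iff_eq (M := historyAutomaton I l h₀ h₁)
    rfl hne (fun q => ⟨l.length + q, Nat.add_lt_add_left q.2 _⟩) (I := I) (fun q a => by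
      have hd : (List.finRange (n + 1))[(q : ℕ)]? = some q :=
        List.getElem?_eq_some_iff.2 ⟨by rw [List.length_finRange]; exact q.2, by simp⟩
      have hr : historyTrans I l (l.length + q) (a h₀).letter? (a h₁).letter? =
          (historyMove I q (a h₀).letter? (a h₁).letter?).map fun r => (l.length + r.1, r.2) := by
        simp only [historyTrans, List.getElem?_eq_none (Nat.le_add_right _ _), Option.elim_none,
          Nat.add_sub_cancel_left, hd, Option.elim_some]
      change Option.map _ (historyTrans I l (l.length + q) (a h₀).letter? (a h₁).letter?) = _
      rw [hr, Option.map_map]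
      congr 1
      funext r
      simp [Nat.mod_eq_of_lt (Nat.add_lt_add_left r.1.2 l.length)]
      rfl) N 0 [] l hN
  rw [List.nil_append] at hT hj hw
  refine ⟨T, ?_, hjh.mono (by omega)⟩
  -- While `l` is being checked only the back head moves, so the simulation begins with nothing
  -- removed and `l` as the queue.
  have key : ∀ i p, p + i = l.length → ∀ w, l.take p <+: w →
      ∀ C : (historyAutomaton I l h₀ h₁).Config w, (C.1 : ℕ) = p → (C.2 h₀ : ℕ) = 1 →
        (C.2 h₁ : ℕ) = p + 1 → ((historyAutomaton I l h₀ h₁).AcceptsFrom w C ↔ w = T) := by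
    intro i
    induction i with
    | zero =>
      intro p hp w hpw C h1 h2 h3
      obtain rfl : p = l.length := hp
      exact hw w (by simpa using hpw) C (Fin.ext (by simp [h1])) h2 h3
    | succ i ih =>
      intro p hp w hpw C h1 h2 h3
      have hpl : p < l.length := by omega
      have ho : (historyAutomaton I l h₀ h₁).options w C =
          Option.map (fun r => {(⟨r.1 % (l.length + (n + 1)), Nat.mod_lt _ (by omega)⟩,
            headMove h₀ h₁ r.2)}) (historyTrans I l C.1 (tapeAt w (C.2 h₀)).letter?
              (tapeAt w (C.2 h₁)).letter?) := rfl
      rw [h1, h3, letter?_tapeAt_succ] at ho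
      simp only [historyTrans, List.getElem?_eq_getElem hpl, Option.elim_some] at ho
      split_ifs at ho with hif
      · obtain ⟨C₁, e1, e2, e3, e4⟩ := exists_acceptsFrom_move (M := historyAutomaton I l h₀ h₁)
          h₁ ho (by have := (List.getElem?_eq_some_iff.1 hif).1; omega)
        rw [e4]
        refine ih (p + 1) (by omega) w ?_ C₁ ?_ (by rw [e3 _ hne, h2]) (by rw [e2, h3])
        · rw [List.prefix_iff_eq_take] at hpw ⊢
          rw [List.length_take_of_le (by omega)] at hpw ⊢
          rw [List.take_add_one, List.take_add_one, hpw, hif]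
          simp [hpl]
        · rw [e1]
          exact Nat.mod_eq_of_lt (by omega)
      · refine iff_of_false (not_acceptsFrom_of_loop ?_) ?_
        · refine ho.trans (congrArg (fun s : Fin (l.length + (n + 1)) =>
            some {(s, (0 : Fin k → SignType))}) (Fin.ext ?_))
          change p % _ = (C.1 : ℕ)
          rw [h1, Nat.mod_eq_of_lt (by omega)]
        · rintro rfl
          refine hif ?_
          obtain ⟨u, rfl⟩ := hT
          rw [List.getElem?_append_left hpl, List.getElem?_eq_getElem hpl]
  ext w
  exact key l.length 0 (by simp) w (by simp) _ rfl rfl rfl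

end

end MultiheadAutomaton

/-! ### Computability of the code of the history automaton -/

namespace MultiheadAutomaton

variable {m n : ℕ} (I : Fin (n + 1) → QueueInstr (Fin m) (Fin (n + 1))) {k : ℕ} (h₀ h₁ : Fin k)

theorem primrec_historyTrans (o₀ o₁ : Option (Fin m)) :
    Primrec fun p : List (Fin m) × ℕ => historyTrans I p.1 p.2 o₀ o₁ := by
  have hlen : Primrec fun p : List (Fin m) × ℕ => p.1.length := Primrec.list_length.comp .fst
  have h1 : Primrec fun p : List (Fin m) × ℕ =>
      (Option.casesOn ((List.finRange (n + 1))[p.2 - p.1.length]?) (some (p.2, none)) fun q =>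
        (historyMove I q o₀ o₁).map fun r => (p.1.length + r.1, r.2) : Option (ℕ × Option Bool)) := by
    refine Primrec.option_casesOn
      ((Primrec.list_getElem?₁ _).comp (Primrec.nat_sub.comp .snd hlen))
      (Primrec.option_some.comp (.pair .snd (.const none))) ?_
    refine Primrec.option_map
      ((Primrec.dom_finite fun q => historyMove I q o₀ o₁).comp .snd) ?_
    exact Primrec.pair (Primrec.nat_add.comp (hlen.comp (.comp .fst .fst))
      (Primrec.fin_val.comp (.comp .fst .snd))) (.comp .snd .snd)
  have h2 : Primrec₂ fun (p : List (Fin m) × ℕ) (b : Fin m) =>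
      if o₁ = some b then some (p.2 + 1, some true) else some (p.2, none) := by
    refine Primrec.ite (Primrec.eq.comp (.const o₁) (Primrec.option_some.comp .snd)) ?_ ?_
    · exact Primrec.option_some.comp
        (.pair (Primrec.succ.comp (.comp .snd .fst)) (.const _))
    · exact Primrec.option_some.comp (.pair (.comp .snd .fst) (.const _))
  refine (Primrec.option_casesOn (Primrec.list_getElem?.comp .fst .snd) h1 h2).of_eq fun p => ?_
  unfold historyTrans
  cases p.1[p.2]? with
  | some b => rfl
  | none =>
    simp only [Option.elim_none]
    cases (List.finRange (n + 1))[p.2 - p.1.length]? <;> rfl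

theorem ofFn_eq_map_range {α : Type*} {N : ℕ} (f : Fin N → α) (g : ℕ → α)
    (h : ∀ i, f i = g i) : List.ofFn f = (List.range N).map g := by
  refine List.ext_getElem (by simp) fun i h1 h2 => ?_
  simp [h]

/-- With `m`, `k` and `I` fixed, symbol and move tuples range over fixed finite types; only the
state indices depend on `l`, and these are listed by `List.range`. -/
theorem primrec_code_historyAutomaton :
    Primrec fun l : List (Fin m) => (historyAutomaton I l h₀ h₁).code := by
  have hN : Primrec fun l : List (Fin m) => l.length + (n + 1) :=
    Primrec.nat_add.comp Primrec.list_length (.const _)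
  have hrange : Primrec fun l : List (Fin m) => List.range (l.length + (n + 1)) :=
    Primrec.list_range.comp hN
  have hacc : Primrec fun l : List (Fin m) =>
      (List.range (l.length + (n + 1))).map fun _ => true :=
    Primrec.list_map hrange (Primrec.const true)
  have htab : Primrec fun l : List (Fin m) =>
      (List.range (l.length + (n + 1))).map fun s => List.ofFn fun a : Fin ((m + 2) ^ k) =>
        (historyTrans I l s (symbolOf (finFunctionFinEquiv.symm a h₀)).letter?
          (symbolOf (finFunctionFinEquiv.symm a h₁)).letter?).map fun r =>
            (List.range (l.length + (n + 1))).map fun s' => List.ofFn fun d : Fin (3 ^ k) =>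
              (s' == r.1 % (l.length + (n + 1)) &&
                decide ((fun i => moveOf (finFunctionFinEquiv.symm d i)) = headMove h₀ h₁ r.2)) := by
    refine Primrec.list_map hrange (Primrec.list_ofFn fun a => ?_)
    refine Primrec.option_map (primrec_historyTrans I _ _) ?_
    refine Primrec.list_map (hrange.comp (.comp .fst .fst)) (Primrec.list_ofFn fun d => ?_)
    refine Primrec.and.comp (Primrec.beq.comp .snd ?_) ?_
    · exact Primrec.nat_mod.comp (.comp .fst (.comp .snd .fst))
        (hN.comp (.comp .fst (.comp .fst .fst)))
    · exact (Primrec.dom_finite fun o : Option Bool =>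
        decide ((fun i => moveOf (finFunctionFinEquiv.symm d i)) = headMove h₀ h₁ o)).comp
          (.comp .snd (.comp .snd .fst))
  refine ((Primrec.const m).pair ((Primrec.const k).pair (hN.pair ((Primrec.const 0).pair
    (hacc.pair htab))))).of_eq fun l => ?_
  have e1 : (List.ofFn fun s : Fin (l.length + (n + 1)) =>
      decide (s ∈ (Finset.univ : Finset (Fin (l.length + (n + 1)))))) =
        (List.range (l.length + (n + 1))).map fun _ => true :=
    ofFn_eq_map_range _ _ fun i => by simp
  refine Prod.ext rfl (Prod.ext rfl (Prod.ext rfl (Prod.ext rfl (Prod.ext e1.symm ?_))))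
  refine (ofFn_eq_map_range _ _ fun s => ?_).symm
  refine congrArg List.ofFn (funext fun a => ?_)
  simp only [historyAutomaton, Option.map_map]
  refine congrArg (Option.map · _) (funext fun r => ?_)
  refine ofFn_eq_map_range _ _ fun s' => ?_
  refine congrArg List.ofFn (funext fun d => ?_)
  rw [Bool.beq_eq_decide_eq, ← Bool.decide_and]
  exact decide_eq_decide.2
    (Finset.mem_singleton.trans (Prod.mk_inj.trans (and_congr_left' Fin.ext_iff)))

end MultiheadAutomaton

/-! ### Computable bounds -/

/-- Sums play the role of maxima: they bound each of their terms. -/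
theorem Computable.sum_range {f : ℕ → ℕ} (hf : Computable f) :
    Computable fun n => ∑ i ∈ Finset.range n, f i := by
  refine (Computable.nat_rec (f := id) (g := fun _ => 0) (h := fun _ p => p.2 + f p.1)
    Computable.id (Computable.const 0) ?_).of_eq fun n => ?_
  · exact Primrec.nat_add.to_comp.comp (Computable.snd.comp Computable.snd)
      (hf.comp (Computable.fst.comp Computable.snd))
  · induction n with
    | zero => rfl
    | succ n ih => simpa [Finset.sum_range_succ] using ih

theorem Computable.of_mem_partrec {α β σ : Type*} [Primcodable α] [Primcodable β] [Primcodable σ]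
    {g : β →. σ} (hg : Partrec g) {h : α → β} (hh : Computable h) {f : α → σ}
    (hf : ∀ a, f a ∈ g (h a)) : Computable f :=
  (hg.comp hh).of_eq fun a => Part.eq_some_iff.2 (hf a)

theorem Computable.exists_search {p : ℕ → ℕ → Bool} (hp : Computable₂ p)
    (h : ∀ n, ∃ i, p n i = true) : ∃ f : ℕ → ℕ, Computable f ∧ ∀ n, p n (f n) = true := by
  have hd : ∀ n, (Nat.rfind fun i => Part.some (p n i)).Dom := fun n => by
    obtain ⟨i, hi⟩ := h n
    obtain ⟨j, hj, -⟩ := Nat.rfind_min' (p := p n) hi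
    exact Part.dom_iff_mem.2 ⟨j, hj⟩
  refine ⟨fun n => (Nat.rfind fun i => Part.some (p n i)).get (hd n), ?_, fun n => ?_⟩
  · exact (Partrec.rfind (p := fun n i => Part.some (p n i)) hp).of_eq fun n =>
      (Part.some_get (hd n)).symm
  · simpa using Nat.rfind_spec (Part.get_mem (hd n))

namespace MultiheadAutomaton

variable {m : ℕ}

/-- The automaton over the alphabet `Fin m` with `n + 1` states and one head that never moves. -/
def idleAutomaton (m n : ℕ) : MultiheadAutomaton m where
  heads := 1
  heads_pos := le_rfl
  states := n + 1
  start := 0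
  accept := ∅
  trans _ _ := none
  left_le := by simp
  le_right := by simp

/-- The number of states of the one-way automata with one head of at most a given size is bounded
by a computable function. -/
theorem exists_computable_states_le {c : (m : ℕ) → MultiheadAutomaton m → ℕ}
    (hc : IsComplexityMeasure (oneWayNondeterministic 1) c) (m : ℕ) :
    ∃ S : ℕ → ℕ, Computable S ∧
      ∀ M ∈ oneWayNondeterministic 1 m, ∀ n, c m M ≤ n → M.states ≤ S n := by
  obtain ⟨g, hg, hgc⟩ := hc.recursive
  obtain ⟨e, he, hmem, hmono⟩ := hc.enumerable m
  -- The default 0 makes pauses harmless: they never satisfy `n < sz i` and add nothing to the sum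
  -- of the `st i`.
  let sz : ℕ → ℕ := fun i => ((e i).map (c m)).getD 0
  let st : ℕ → ℕ := fun i => ((e i).map states).getD 0
  have hsz : Computable sz := by
    have := Partrec.optionCasesOn_right he (Computable.const 0) (hg.comp Computable.snd).to₂
    refine this.of_eq fun i => ?_
    rcases hi : e i with _ | M
    · simp [sz, hi]
    · have := Part.eq_some_iff.2 (hgc m M ((hmem M).2 ⟨i, hi⟩))
      simp [sz, hi, this]
  have hst : Computable st := by
    have h2 : Computable fun y : AutomatonCode => y.2.2.1 :=
      Computable.fst.comp (Computable.snd.comp Computable.snd)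
    refine (Computable.option_getD (Computable.option_map he (h2.comp Computable.snd).to₂)
      (Computable.const 0)).of_eq fun i => ?_
    rcases hi : e i with _ | M <;> simp [st, hi, code]
  -- The idle automata are infinitely many, while only finitely many automata have size at most `n`.
  have hunb : ∀ n, ∃ i, decide (n < sz i) = true := by
    intro n
    by_contra! hcon
    have hfin : (⋃ j ∈ Finset.range (n + 1),
        {M | M ∈ oneWayNondeterministic 1 m ∧ c m M = j}).Finite :=
      Set.Finite.biUnion (Finset.finite_toSet _) fun j _ => hc.finite m j
    refine Set.infinite_range_of_injective (f := idleAutomaton m) ?_ (hfin.subset ?_)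
    · intro a b hab
      simpa [idleAutomaton] using congrArg states hab
    · rintro _ ⟨a, rfl⟩
      have ha : idleAutomaton m a ∈ oneWayNondeterministic 1 m :=
        ⟨rfl, fun s a T h => by simp [idleAutomaton] at h⟩
      obtain ⟨i, hi⟩ := (hmem _).1 ha
      have := hcon i
      simp only [sz, hi] at this
      simp at this
      simp only [Set.mem_iUnion]
      exact ⟨_, Finset.mem_range.2 (Nat.lt_succ_of_le this), ha, rfl⟩
  have hp : Computable₂ fun n i => decide (n < sz i) := by
    have h : Primrec₂ fun a b : ℕ => decide (a < b) := Primrec.nat_lt.decide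
    exact h.to_comp.comp Computable.fst (hsz.comp Computable.snd)
  obtain ⟨f, hf, hfs⟩ := Computable.exists_search hp hunb
  refine ⟨fun n => ∑ i ∈ Finset.range (f n), st i, (Computable.sum_range hst).comp hf, ?_⟩
  intro M hM n hn
  obtain ⟨j, hj⟩ := (hmem M).1 hM
  -- Sizes increase along the enumeration, so whatever comes from index `f n` on is larger than `n`.
  have hlt : j < f n := by
    by_contra! hle
    have h := hfs n
    rcases hi : e (f n) with _ | M'
    · simp [sz, hi] at h
    · have := hmono _ _ _ _ hle hi hj
      simp [sz, hi] at h
      omega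
  have := Finset.single_le_sum (f := st) (fun _ _ => Nat.zero_le _) (Finset.mem_range.2 hlt)
  simpa [st, hj] using this

end MultiheadAutomaton

/-! ### A queue machine with an undecidable halting problem -/

namespace QueueInstr

/-- The renaming of letters and states. -/
def rename {Γ Γ' Q Q' : Type*} (φ : Γ ≃ Γ') (ψ : Q → Q') : QueueInstr Γ Q → QueueInstr Γ' Q'
  | push b q => push (φ b) (ψ q)
  | pop f => pop fun a => ψ (f (φ.symm a))
  | halt => halt

/-- The next state always lies in `P`. -/
def Supports {Γ Q : Type*} (P : Set Q) : QueueInstr Γ Q → Prop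
  | push _ q => q ∈ P
  | pop f => ∀ a, f a ∈ P
  | halt => True

end QueueInstr

/-- Since `P` is closed under steps, `ψ` needs a left inverse on `P` only; thus an infinite state
type can be cut down to a finite part. -/
theorem haltsWithin_rename_iff {Γ Γ' Q Q' : Type*} {I : Q → QueueInstr Γ Q} {P : Set Q}
    (hI : ∀ q ∈ P, (I q).Supports P) (φ : Γ ≃ Γ') (ψ : Q → Q') {s : Q' → Q}
    (hs : ∀ q ∈ P, s (ψ q) = q) (n : ℕ) {q : Q} (hq : q ∈ P) (l : List Γ) :
    HaltsWithin (fun i => (I (s i)).rename φ ψ) n (ψ q, l.map φ) ↔ HaltsWithin I n (q, l) := by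
  induction n generalizing q l with
  | zero => exact iff_of_false not_haltsWithin_zero not_haltsWithin_zero
  | succ n ih =>
    have h := hI q hq
    cases hc : I q with
    | push b q' =>
      rw [hc] at h
      rw [haltsWithin_succ_of_step (c' := (q', l ++ [b])) (by simp [queueStep, hc]), ← ih h,
        haltsWithin_succ_of_step (by simp [queueStep, hs q hq, hc, QueueInstr.rename]; rfl)]
      simp
    | pop f =>
      rw [hc] at h
      cases l with
      | nil =>
        rw [haltsWithin_succ_of_step (c' := (q, [])) (by simp [queueStep, hc]), ← ih hq,
          haltsWithin_succ_of_step (by simp [queueStep, hs q hq, hc, QueueInstr.rename]; rfl)]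
        simp
      | cons a l =>
        rw [haltsWithin_succ_of_step (c' := (f a, l)) (by simp [queueStep, hc]), ← ih (h a),
          haltsWithin_succ_of_step (by simp [queueStep, hs q hq, hc, QueueInstr.rename]; rfl)]
    | halt =>
      refine iff_of_true (HaltsWithin.mono (haltsWithin_one.2 ?_) (by omega))
        (HaltsWithin.mono (haltsWithin_one.2 ?_) (by omega)) <;>
      simp [queueStep, hs q hq, hc, QueueInstr.rename]

theorem exists_fin_queueMachine {Γ Q : Type*} [Finite Γ] {I : Q → QueueInstr Γ Q} {P : Set Q}
    (hP : P.Finite) (hI : ∀ q ∈ P, (I q).Supports P) {q₀ : Q} (h₀ : q₀ ∈ P) :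
    ∃ (m n : ℕ) (φ : Γ ≃ Fin m) (I' : Fin (n + 1) → QueueInstr (Fin m) (Fin (n + 1))),
      ∀ N l, HaltsWithin I' N (0, l.map φ) ↔ HaltsWithin I N (q₀, l) := by
  classical
  have := hP.to_subtype
  obtain ⟨m, ⟨φ⟩⟩ := Finite.exists_equiv_fin Γ
  obtain ⟨n, ⟨e⟩⟩ := Finite.exists_equiv_fin P
  obtain ⟨n, rfl⟩ : ∃ n', n = n' + 1 := Nat.exists_eq_succ_of_ne_zero fun h => by
    subst h
    exact (e ⟨q₀, h₀⟩).elim0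
  -- The swap makes 0 the number of the initial state.
  let e' := e.trans (Equiv.swap (e ⟨q₀, h₀⟩) 0)
  let ψ : Q → Fin (n + 1) := fun q => if h : q ∈ P then e' ⟨q, h⟩ else 0
  have hψ : ψ q₀ = 0 := by simp [ψ, h₀, e']
  refine ⟨m, n, φ, fun i => (I (e'.symm i)).rename φ ψ, fun N l => ?_⟩
  rw [← hψ]
  exact haltsWithin_rename_iff hI φ ψ (s := fun i => (e'.symm i : Q))
    (fun q hq => by simp [ψ, hq]) N h₀ l

/-! ### Simulation of four stacks by a queue -/

namespace StackQueue

open Turing Turing.PartrecToTM2 Relation StateTransition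

/-- The cyclic order of the four stacks. -/
def next : K' → K'
  | .main => .rev
  | .rev => .aux
  | .aux => .stack
  | .stack => .main

instance : Finite K' := Finite.of_injective (β := Fin 4)
  (fun | .main => 0 | .rev => 1 | .aux => 2 | .stack => 3) fun a b h => by
    cases a <;> cases b <;> simp_all

variable {Γ Λ σ : Type*}

/-- The contents of the stacks other than `j`, each stack being preceded by its name but for the
first one. -/
def others (j : K') (S : K' → List Γ) : List (K' ⊕ Γ) :=
  (S (next j)).map .inr ++ .inl (next (next j)) :: ((S (next (next j))).map .inr ++
    .inl (next (next (next j))) :: (S (next (next (next j)))).map .inr)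

/-- The contents of the four stacks as a queue, starting with the stack `j`. -/
def content (j : K') (S : K' → List Γ) : List (K' ⊕ Γ) :=
  (S j).map .inr ++ .inl (next j) :: others j S

theorem others_append (j : K') (S : K' → List Γ) (l : List Γ) :
    others j S ++ .inl j :: l.map .inr = content (next j) (Function.update S j l) := by
  cases j <;> simp [others, content, next, Function.update]

/-- The states of the queue machine that simulates a machine with four stacks; `q` is the statement
to be executed and `v` the contents of the local store. In `start j q v`, the queue begins with the
contents of the stack `j`, whose name has been removed. In the other states, the contents of a stack
are being moved to the back of the queue: `copy` takes the next letter, `emit a` appends `a`, and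
`top` takes the top of the stack in order to execute `q`. -/
inductive State (Γ Λ σ : Type*)
  | start (j : K') (q : TM2.Stmt (fun _ : K' => Γ) Λ σ) (v : σ)
  | emit (a : Γ) (q : TM2.Stmt (fun _ : K' => Γ) Λ σ) (v : σ)
  | copy (q : TM2.Stmt (fun _ : K' => Γ) Λ σ) (v : σ)
  | top (q : TM2.Stmt (fun _ : K' => Γ) Λ σ) (v : σ)

/-- The state after the top of a stack has been read in order to execute `q`. -/
def afterTop (q : TM2.Stmt (fun _ : K' => Γ) Λ σ) (v : σ) : K' ⊕ Γ → State Γ Λ σ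
  | .inr a => match q with
    | .peek _ f q' => .emit a q' (f v (some a))
    | .pop _ f q' => .copy q' (f v (some a))
    | q => .copy q v
  | .inl j => match q with
    | .peek _ f q' => .start j q' (f v none)
    | .pop _ f q' => .start j q' (f v none)
    | q => .start j q v

/-- The program of the queue machine that simulates the stack machine `M`. -/
def instr (M : Λ → TM2.Stmt (fun _ : K' => Γ) Λ σ) :
    State Γ Λ σ → QueueInstr (K' ⊕ Γ) (State Γ Λ σ)
  | .start _ .halt _ => .halt
  | .start j (.push k f q) v =>
    .push (.inl j) (if j = k then .emit (f v) q v else .copy (.push k f q) v)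
  | .start j (.peek k f q) v =>
    .push (.inl j) (if j = k then .top (.peek k f q) v else .copy (.peek k f q) v)
  | .start j (.pop k f q) v =>
    .push (.inl j) (if j = k then .top (.pop k f q) v else .copy (.pop k f q) v)
  | .start j (.load f q) v => .push (.inl j) (.copy q (f v))
  | .start j (.branch p q₁ q₂) v => .push (.inl j) (.copy (cond (p v) q₁ q₂) v)
  | .start j (.goto f) v => .push (.inl j) (.copy (M (f v)) v)
  | .emit a q v => .push (.inr a) (.copy q v)
  | .copy q v => .pop fun c => c.elim (fun j => .start j q v) fun a => .emit a q v
  | .top q v => .pop (afterTop q v)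

variable {M : Λ → TM2.Stmt (fun _ : K' => Γ) Λ σ}

theorem reaches_copy (q : TM2.Stmt (fun _ : K' => Γ) Λ σ) (v : σ) (j : K') (l : List Γ)
    (r : List (K' ⊕ Γ)) : Reaches₁ (queueStep (instr M))
      (.copy q v, l.map .inr ++ .inl j :: r) (.start j q v, r ++ l.map .inr) := by
  induction l generalizing r with
  | nil => exact .single (by simp [queueStep, instr])
  | cons a l ih =>
    refine .head (b := (.emit a q v, l.map .inr ++ .inl j :: r)) (by simp [queueStep, instr]) ?_
    refine .head (b := (.copy q v, l.map .inr ++ .inl j :: (r ++ [.inr a])))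
      (by simp [queueStep, instr]) ?_
    have := ih (r ++ [.inr a])
    rw [List.append_assoc] at this
    exact this

/-- One rotation: `p` is the part of the new stack `j` already at the back, `l` the part still to be
carried there. -/
theorem reaches_copy_next (q : TM2.Stmt (fun _ : K' => Γ) Λ σ) (v : σ) (j : K') (S : K' → List Γ)
    (p l : List Γ) : Reaches₁ (queueStep (instr M))
      (.copy q v, l.map .inr ++ .inl (next j) :: (others j S ++ .inl j :: p.map .inr))
      (.start (next j) q v, content (next j) (Function.update S j (p ++ l))) := by
  rw [← others_append]
  have := reaches_copy (M := M) q v (next j) l (others j S ++ .inl j :: p.map .inr)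
  rw [List.append_assoc, List.cons_append, ← List.map_append] at this
  exact this

theorem reaches_next_of_push_copy {q q' : TM2.Stmt (fun _ : K' => Γ) Λ σ} {v v' : σ} {j : K'}
    (h : instr M (.start j q v) = .push (.inl j) (.copy q' v')) (S : K' → List Γ) :
    Reaches₁ (queueStep (instr M)) (.start j q v, content j S)
      (.start (next j) q' v', content (next j) S) := by
  refine .head (b := (.copy q' v', content j S ++ [.inl j])) (by simp [queueStep, h]) ?_
  have := reaches_copy_next (M := M) q' v' j S [] (S j)
  simpa [content, Reaches₁] using this

/-- A statement that concerns stack `k` waits unchanged while the queue is rotated, at most three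
times, until `k` is in front. -/
theorem reaches_start_of_forall {q : TM2.Stmt (fun _ : K' => Γ) Λ σ} {v : σ} {k : K'}
    (h : ∀ j, j ≠ k → instr M (.start j q v) = .push (.inl j) (.copy q v)) (j : K')
    (S : K' → List Γ) :
    Reaches (queueStep (instr M)) (.start j q v, content j S) (.start k q v, content k S) := by
  have hn : ∀ j, j ≠ k → Reaches (queueStep (instr M)) (.start j q v, content j S)
      (.start (next j) q v, content (next j) S) :=
    fun j hj => (reaches_next_of_push_copy (h j hj) S).to_reflTransGen
  have hk : next (next (next (next k))) = k := by cases k <;> rfl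
  have h1 : ∀ j, next j = k → Reaches (queueStep (instr M)) (.start j q v, content j S)
      (.start k q v, content k S) := fun j hj => by
    subst hj
    exact hn j (by cases j <;> simp [next])
  have h2 : ∀ j, next (next j) = k → Reaches (queueStep (instr M)) (.start j q v, content j S)
      (.start k q v, content k S) := fun j hj =>
    (hn j (by subst hj; cases j <;> simp [next])).trans (h1 _ hj)
  have h3 : ∀ j, next (next (next j)) = k → Reaches (queueStep (instr M))
      (.start j q v, content j S) (.start k q v, content k S) := fun j hj =>
    (hn j (by subst hj; cases j <;> simp [next])).trans (h2 _ hj)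
  rcases (by cases j <;> cases k <;> simp [next] :
    j = k ∨ next j = k ∨ next (next j) = k ∨ next (next (next j)) = k) with hj | hj | hj | hj
  · subst hj
    exact .refl
  exacts [h1 j hj, h2 j hj, h3 j hj]

/-- The configurations of the queue machine that stand for a configuration of the stack machine. -/
def Represents : TM2.Cfg (fun _ : K' => Γ) Λ σ → State Γ Λ σ × List (K' ⊕ Γ) → Prop
  | ⟨some a, v, S⟩, d => ∃ j f, f v = a ∧ d = (.start j (.goto f) v, content j S)
  | ⟨none, v, S⟩, d => ∃ j, d = (.start j .halt v, content j S)

/-- By induction on the statement: each elementary action is performed during one rotation, with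
stack `k` in front where a stack is involved. The run stops before a `goto` or `halt`, where
`Represents` leaves the front stack arbitrary. -/
theorem exists_represents_stepAux (q : TM2.Stmt (fun _ : K' => Γ) Λ σ) (v : σ)
    (S : K' → List Γ) (j : K') : ∃ d, Represents (TM2.stepAux q v S) d ∧
      Reaches (queueStep (instr M)) (.start j q v, content j S) d := by
  induction q generalizing v S j with
  | push k f q ih =>
    obtain ⟨d, hd, hr⟩ := ih v (Function.update S k (f v :: S k)) (next k)
    refine ⟨d, hd, (reaches_start_of_forall (k := k) (fun j hj => by simp [instr, hj]) j S).trans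
      (.trans ?_ hr)⟩
    refine .head (b := (.emit (f v) q v, content k S ++ [.inl k])) (by simp [queueStep, instr]) ?_
    refine .head (b := (.copy q v, content k S ++ [.inl k, .inr (f v)]))
      (by simp [queueStep, instr]) ?_
    have := reaches_copy_next (M := M) q v k S [f v] (S k)
    simpa [content] using this.to_reflTransGen
  | peek k f q ih =>
    obtain ⟨d, hd, hr⟩ := ih (f v (S k).head?) S (next k)
    refine ⟨d, hd, (reaches_start_of_forall (k := k) (fun j hj => by simp [instr, hj]) j S).trans
      (.trans ?_ hr)⟩
    refine .head (b := (.top (.peek k f q) v, content k S ++ [.inl k]))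
      (by simp [queueStep, instr]) ?_
    rcases hS : S k with _ | ⟨a, l⟩
    · have := others_append k S []
      rw [show Function.update S k [] = S by rw [← hS, Function.update_eq_self]] at this
      rw [← this]
      exact .single (by simp [content, hS, queueStep, instr, afterTop])
    · have := reaches_copy_next (M := M) q (f v (some a)) k S [a] l
      rw [List.singleton_append, ← hS, Function.update_eq_self] at this
      refine .head (b := (.emit a q (f v (some a)), l.map .inr ++ .inl (next k) ::
        (others k S ++ [.inl k]))) (by simp [content, hS, queueStep, instr, afterTop]) ?_
      refine .head (b := (.copy q (f v (some a)), l.map .inr ++ .inl (next k) ::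
        (others k S ++ .inl k :: [a].map .inr))) (by simp [queueStep, instr]) ?_
      exact this.to_reflTransGen
  | pop k f q ih =>
    obtain ⟨d, hd, hr⟩ := ih (f v (S k).head?) (Function.update S k (S k).tail) (next k)
    refine ⟨d, hd, (reaches_start_of_forall (k := k) (fun j hj => by simp [instr, hj]) j S).trans
      (.trans ?_ hr)⟩
    refine .head (b := (.top (.pop k f q) v, content k S ++ [.inl k]))
      (by simp [queueStep, instr]) ?_
    rcases hS : S k with _ | ⟨a, l⟩
    · have := others_append k S []
      rw [List.tail_nil, ← this]
      exact .single (by simp [content, hS, queueStep, instr, afterTop])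
    · have := reaches_copy_next (M := M) q (f v (some a)) k S [] l
      refine .head (b := (.copy q (f v (some a)), l.map .inr ++ .inl (next k) ::
        (others k S ++ .inl k :: [].map .inr))) (by
          simp [content, hS, queueStep, instr, afterTop]) ?_
      exact this.to_reflTransGen
  | load f q ih =>
    obtain ⟨d, hd, hr⟩ := ih (f v) S (next j)
    exact ⟨d, hd, (reaches_next_of_push_copy rfl S).to_reflTransGen.trans hr⟩
  | branch p q₁ q₂ ih₁ ih₂ =>
    rcases hp : p v with _ | _
    · obtain ⟨d, hd, hr⟩ := ih₂ v S (next j)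
      exact ⟨d, by simpa [hp] using hd,
        (reaches_next_of_push_copy (by simp [instr, hp]) S).to_reflTransGen.trans hr⟩
    · obtain ⟨d, hd, hr⟩ := ih₁ v S (next j)
      exact ⟨d, by simpa [hp] using hd,
        (reaches_next_of_push_copy (by simp [instr, hp]) S).to_reflTransGen.trans hr⟩
  | goto f => exact ⟨_, ⟨j, f, rfl, rfl⟩, .refl⟩
  | halt => exact ⟨_, ⟨j, rfl⟩, .refl⟩

/-- Executing the pending `goto` costs a rotation, which supplies the nonempty run that `Respects`
demands. -/
theorem respects_represents : Respects (TM2.step M) (queueStep (instr M)) Represents := by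
  rintro ⟨_ | a, v, S⟩ d hd
  · obtain ⟨j, rfl⟩ := hd
    simp [queueStep, instr]
  · obtain ⟨j, f, rfl, rfl⟩ := hd
    obtain ⟨d, hd, hr⟩ := exists_represents_stepAux (M := M) (M (f v)) v S (next j)
    exact ⟨d, hd, .trans_left (reaches_next_of_push_copy rfl S) hr⟩

/-- The states in which the statement belongs to `Q`. -/
def statesOver (Q : Set (TM2.Stmt (fun _ : K' => Γ) Λ σ)) : Set (State Γ Λ σ) :=
  {s | match s with | .start _ q _ | .emit _ q _ | .copy q _ | .top q _ => q ∈ Q}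

theorem finite_statesOver [Finite Γ] [Finite σ] {Q : Set (TM2.Stmt (fun _ : K' => Γ) Λ σ)}
    (hQ : Q.Finite) : (statesOver Q).Finite := by
  have := hQ.to_subtype
  let g : (K' ⊕ Γ ⊕ Bool) × Q × σ → State Γ Λ σ
    | (.inl j, q, v) => .start j q v
    | (.inr (.inl a), q, v) => .emit a q v
    | (.inr (.inr true), q, v) => .copy q v
    | (.inr (.inr false), q, v) => .top q v
  refine (Set.finite_range g).subset ?_
  rintro (⟨j, q, v⟩ | ⟨a, q, v⟩ | ⟨q, v⟩ | ⟨q, v⟩) hs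
  · exact ⟨(.inl j, ⟨q, hs⟩, v), rfl⟩
  · exact ⟨(.inr (.inl a), ⟨q, hs⟩, v), rfl⟩
  · exact ⟨(.inr (.inr true), ⟨q, hs⟩, v), rfl⟩
  · exact ⟨(.inr (.inr false), ⟨q, hs⟩, v), rfl⟩

/-- The type of statements is infinite, but a run meets only substatements of the program on its
supported labels. -/
theorem supports_instr {A : Finset Λ} {Q : Set (TM2.Stmt (fun _ : K' => Γ) Λ σ)}
    (hM : ∀ a ∈ A, M a ∈ Q)
    (hQ : ∀ q ∈ Q, TM2.SupportsStmt A q ∧ ∀ q' ∈ TM2.stmts₁ q, q' ∈ Q) :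
    ∀ s ∈ statesOver Q, (instr M s).Supports (statesOver Q) := by
  rintro (⟨j, q, v⟩ | ⟨a, q, v⟩ | ⟨q, v⟩ | ⟨q, v⟩) (hs : q ∈ Q)
  · obtain ⟨h1, h2⟩ := hQ q hs
    cases q with
    | push k f q =>
      have : q ∈ Q := h2 q (by simp [TM2.stmts₁, TM2.stmts₁_self])
      simp only [instr, QueueInstr.Supports]
      split_ifs <;> assumption
    | peek k f q | pop k f q =>
      simp only [instr, QueueInstr.Supports]
      split_ifs <;> exact hs
    | load f q => exact h2 q (by simp [TM2.stmts₁, TM2.stmts₁_self])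
    | branch p q₁ q₂ =>
      have e1 : q₁ ∈ Q := h2 q₁ (by simp [TM2.stmts₁, TM2.stmts₁_self])
      have e2 : q₂ ∈ Q := h2 q₂ (by simp [TM2.stmts₁, TM2.stmts₁_self])
      change cond (p v) q₁ q₂ ∈ Q
      cases p v <;> assumption
    | goto f => exact hM _ (h1 v)
    | halt => trivial
  · exact hs
  · rintro (j | a) <;> exact hs
  · obtain ⟨h1, h2⟩ := hQ q hs
    rintro (j | a) <;> cases q with
    | peek k f q | pop k f q => exact h2 q (by simp [TM2.stmts₁, TM2.stmts₁_self])
    | _ => exact hs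

end StackQueue

namespace Turing.PartrecToTM2

noncomputable instance : Primcodable Γ' := Primcodable.ofEquiv _ (Fintype.equivFin Γ')

/-- The binary successor. -/
def binarySucc : List Γ' → List Γ' :=
  fun l => List.recOn l [Γ'.bit1] fun b l ih => if b = Γ'.bit0 then Γ'.bit1 :: l else Γ'.bit0 :: ih

theorem primrec_binarySucc : Primrec binarySucc := by
  refine Primrec.list_rec Primrec.id (Primrec.const _) (h := fun _ p =>
    if p.1 = Γ'.bit0 then Γ'.bit1 :: p.2.1 else Γ'.bit0 :: p.2.2) ?_
  refine Primrec.ite (Primrec.eq.comp (.comp .fst .snd) (.const _)) ?_ ?_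
  · exact Primrec.list_cons.comp (.const _) (.comp .fst (.comp .snd .snd))
  · exact Primrec.list_cons.comp (.const _) (.comp .snd (.comp .snd .snd))

theorem trPosNum_succ (n : PosNum) : trPosNum n.succ = binarySucc (trPosNum n) := by
  induction n with
  | one => rfl
  | bit0 n _ => rfl
  | bit1 n ih =>
    change Γ'.bit0 :: trPosNum n.succ = Γ'.bit0 :: binarySucc (trPosNum n)
    rw [ih]

theorem trNat_succ (n : ℕ) : trNat (n + 1) = binarySucc (trNat n) := by
  rw [trNat, trNat, Nat.cast_succ, Num.add_one]
  cases (n : Num) with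
  | zero => rfl
  | pos p => exact trPosNum_succ p

/-- Iterating the binary successor makes the binary notation a primitive recursion on the number
itself. -/
theorem primrec_trNat : Primrec trNat := by
  refine (Primrec.nat_rec₁ (f := fun _ l => binarySucc l) []
    (primrec_binarySucc.comp .snd)).of_eq fun n => ?_
  induction n with
  | zero => exact trNat_zero.symm
  | succ n ih => rw [trNat_succ, ← ih]

end Turing.PartrecToTM2

open Turing Turing.PartrecToTM2 StackQueue in
/-- A queue machine with an undecidable halting problem. -/
theorem exists_queueMachine_not_computablePred :
    ∃ (m n : ℕ) (I : Fin (n + 1) → QueueInstr (Fin m) (Fin (n + 1))) (inp : ℕ → List (Fin m)),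
      Primrec inp ∧ ¬ ComputablePred fun x => ∃ N, HaltsWithin I N (0, inp x) := by
  -- Domain of `F`: the codes that halt on input 0, an undecidable set.
  let F : ℕ →. ℕ := fun x => Nat.Partrec.Code.eval (Denumerable.ofNat Nat.Partrec.Code x) 0
  have hF : Partrec F :=
    Nat.Partrec.Code.eval_part.comp (Computable.ofNat _) (Computable.const 0)
  obtain ⟨c, hc⟩ := ToPartrec.Code.exists_code (Nat.Partrec'.part_iff₁.2 hF)
  have hsupp := (tr_supports c .halt).2
  have hself : trNormal c .halt ∈ codeSupp c .halt := (tr_supports c .halt).1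
  -- The extra `goto` is the pending statement of the initial configuration; it need not occur in
  -- the program.
  let Q : Set (TM2.Stmt (fun _ : K' => Γ') Λ' (Option Γ')) :=
    {.goto fun _ => trNormal c .halt} ∪
      {q | ∃ a ∈ codeSupp c .halt, q ∈ TM2.stmts₁ (tr a)}
  have hQ : Q.Finite := by
    refine (Set.finite_singleton _).union ?_
    refine (Set.Finite.biUnion (codeSupp c .halt).finite_toSet
      fun a _ => (TM2.stmts₁ (tr a)).finite_toSet).subset ?_
    rintro q ⟨a, ha, hq⟩
    simp only [Set.mem_iUnion]
    exact ⟨a, ha, hq⟩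
  obtain ⟨m, n, φ, I, hI⟩ := exists_fin_queueMachine (finite_statesOver hQ)
    (supports_instr (M := tr) (fun a ha => .inr ⟨a, ha, TM2.stmts₁_self⟩) (by
      rintro q (rfl | ⟨a, ha, hq⟩)
      · refine ⟨fun _ => hself, fun q' hq' => .inl ?_⟩
        simpa [TM2.stmts₁] using hq'
      · exact ⟨TM2.stmts₁_supportsStmt_mono hq (hsupp a ha),
          fun q' hq' => .inr ⟨a, ha, TM2.stmts₁_trans hq hq'⟩⟩))
    (q₀ := .start .main (.goto fun _ => trNormal c .halt) none) (.inl rfl)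
  -- The queue for a main stack holding `x` and three empty stacks, of which only the names remain;
  -- the name of the front stack is omitted.
  let inp : ℕ → List (Fin m) := fun x =>
    (trNat x ++ [Γ'.cons]).map (fun a => φ (.inr a)) ++
      [φ (.inl .rev), φ (.inl .aux), φ (.inl .stack)]
  refine ⟨m, n, I, inp, ?_, fun hcomp => ?_⟩
  · refine Primrec.list_append.comp (Primrec.list_map ?_ ?_) (.const _)
    · exact Primrec.list_append.comp primrec_trNat (.const _)
    · exact (Primrec.dom_finite fun a => φ (.inr a)).comp .snd
  · have key : ∀ x, (∃ N, HaltsWithin I N (0, inp x)) ↔ (F x).Dom := by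
      intro x
      have hx : inp x = (content .main (K'.elim (trList [x]) [] [] [])).map φ := by
        simp [inp, content, others, next, Function.comp_def]
      rw [hx]
      simp only [hI]
      rw [exists_haltsWithin_iff]
      rw [StateTransition.tr_eval_dom (respects_represents (M := tr))
        (a₁ := ⟨some (trNormal c .halt), none, K'.elim (trList [x]) [] [] []⟩)
        ⟨.main, _, rfl, rfl⟩]
      have h1 := tr_eval c [x]
      have h2 := hc (x ::ᵥ .nil)
      change c.eval [x] = pure <$> F x at h2
      rw [h2] at h1
      change (StateTransition.eval (TM2.step tr) (init c [x])).Dom ↔ _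
      rw [h1]
      rfl
    refine ComputablePred.halting_problem 0 ?_
    have := hcomp.of_eq key
    have h2 : ComputablePred fun a : Nat.Partrec.Code => (F (Encodable.encode a)).Dom :=
      ComputablePred.computable_of_manyOneReducible ⟨_, Computable.encode, fun _ => Iff.rfl⟩ this
    exact h2.of_eq fun a => by simp [F]

/-! ### Decidability of halting within a computable bound -/

theorem primrec_queueStep {m n : ℕ} (I : Fin n → QueueInstr (Fin m) (Fin n)) :
    Primrec fun c : Fin n × List (Fin m) => queueStep I c := by
  -- For a state and the first letter: the new state, what replaces that letter, and what is
  -- appended. Its domain is finite, hence it is primitive recursive.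
  let A : Fin n × Fin m → Option (Fin n × List (Fin m) × List (Fin m)) := fun p => match I p.1 with
    | .push b q => some (q, [p.2], [b])
    | .pop f => some (f p.2, [], [])
    | .halt => none
  have h : Primrec₂ fun (c : Fin n × List (Fin m)) (p : Fin m × List (Fin m)) =>
      (A (c.1, p.1)).map fun r => (r.1, r.2.1 ++ p.2 ++ r.2.2) := by
    refine Primrec.option_map
      ((Primrec.dom_finite A).comp (.pair (.comp .fst .fst) (.comp .fst .snd))) ?_
    exact Primrec.pair (.comp .fst .snd) (Primrec.list_append.comp (Primrec.list_append.comp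
      (.comp .fst (.comp .snd .snd)) (.comp .snd (.comp .snd .fst))) (.comp .snd (.comp .snd .snd)))
  have h := Primrec.list_casesOn .snd
    ((Primrec.dom_finite fun q => queueStep I (q, [])).comp .fst) h
  refine h.of_eq ?_
  rintro ⟨q, _ | ⟨a, l⟩⟩
  · rfl
  · cases hq : I q <;> simp [queueStep, A, hq]

theorem computablePred_haltsWithin {m n : ℕ}
    (I : Fin (n + 1) → QueueInstr (Fin m) (Fin (n + 1))) {inp : ℕ → List (Fin m)}
    (hinp : Computable inp) {N : ℕ → ℕ} (hN : Computable N) :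
    ComputablePred fun x => HaltsWithin I (N x) (0, inp x) := by
  have h : Primrec fun p : ℕ × List (Fin m) =>
      ((fun o : Option (Fin (n + 1) × List (Fin m)) => o.bind (queueStep I))^[p.1]
        (some (0, p.2))).isSome := by
    refine Primrec.option_isSome.comp (Primrec.nat_iterate .fst
      (Primrec.option_some.comp (.pair (.const 0) .snd)) ?_)
    exact Primrec.option_bind .snd ((primrec_queueStep I).comp .snd)
  refine ComputablePred.computable_iff.2 ⟨_,
    Primrec.not.to_comp.comp (h.to_comp.comp (hN.pair hinp)), funext fun x => ?_⟩
  simp [HaltsWithin]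

theorem Computable.two_pow {f : ℕ → ℕ} (hf : Computable f) : Computable fun x => 2 ^ f x := by
  have h : Primrec fun n : ℕ => 2 ^ n :=
    (Primrec.nat_rec₁ (f := fun _ y => 2 * y) 1
      (Primrec.nat_mul.comp (.const 2) .snd)).of_eq fun n => by
        induction n with
        | zero => rfl
        | succ n ih => rw [pow_succ, ← ih]; exact Nat.mul_comm _ _
  exact h.to_comp.comp hf

/-! ### The non-recursive trade-off -/

open MultiheadAutomaton in
theorem mainTheorem6 (k : ℕ) (hk : 2 ≤ k) (c : (m : ℕ) → MultiheadAutomaton m → ℕ)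
    (hc₁ : IsComplexityMeasure (oneWayDeterministic k) c)
    (hc₂ : IsComplexityMeasure (oneWayNondeterministic 1) c) :
    IsNonRecursiveTradeoff (oneWayDeterministic k) (oneWayNondeterministic 1) c := by
  rintro ⟨f, hf, -, hbound⟩
  obtain ⟨m, n, I, inp, hinp, hundec⟩ := exists_queueMachine_not_computablePred
  obtain ⟨S, hS, hstates⟩ := exists_computable_states_le hc₂ m
  let h₀ : Fin k := ⟨0, by omega⟩
  let h₁ : Fin k := ⟨1, by omega⟩
  have hne : h₀ ≠ h₁ := by simp [h₀, h₁]
  let D : ℕ → MultiheadAutomaton m := fun x => historyAutomaton I (inp x) h₀ h₁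
  have hD : ∀ x, D x ∈ oneWayDeterministic k m := fun x => historyAutomaton_mem ..
  obtain ⟨g, hg, hgc⟩ := hc₁.recursive
  have hsize : Computable fun x => c m (D x) :=
    .of_mem_partrec hg ((primrec_code_historyAutomaton I h₀ h₁).comp hinp).to_comp
      fun x => hgc m _ (hD x)
  -- A monotone majorant of `f`: the minimal size is only known to be at most `c m (D x)`, and `f`
  -- need not be monotone.
  let F : ℕ → ℕ := fun n => ∑ i ∈ Finset.range (n + 1), f i
  have hF : Computable F := hf.sum_range.comp Computable.succ
  -- From halting within 2|T| + 1 and |T| < 2 ^ states.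
  let B : ℕ → ℕ := fun x => 2 * 2 ^ S (F (c m (D x))) + 1
  have hB : Computable B := Computable.succ.comp (Primrec.nat_mul.to_comp.comp
    (Computable.const 2) (hS.comp (hF.comp hsize)).two_pow)
  refine hundec ((computablePred_haltsWithin I hinp.to_comp hB).of_eq fun x => ?_)
  -- Only halting inputs need an argument, so the bound is applied to singleton languages alone.
  refine ⟨fun h => ⟨_, h⟩, fun ⟨N, hN⟩ => ?_⟩
  obtain ⟨T, hL, hT⟩ := exists_language_historyAutomaton_eq (h₀ := h₀) (h₁ := h₁) hne hN
  have hdesc : (descriptors (oneWayNondeterministic 1) ({T} : Language (Fin m))).Nonempty :=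
    ⟨_, singletonAutomaton_mem T⟩
  have hmem : D x ∈ descriptors (oneWayDeterministic k) ({T} : Language (Fin m)) := ⟨hD x, hL⟩
  obtain ⟨M, ⟨⟨hM1, hM2⟩, hML⟩, hMc⟩ := Nat.sInf_mem (hdesc.image (c m))
  have hle : minSize (oneWayDeterministic k) c ({T} : Language (Fin m)) ≤ c m (D x) :=
    Nat.sInf_le ⟨_, hmem, rfl⟩
  have hMF : c m M ≤ F (c m (D x)) :=
    calc c m M = minSize (oneWayNondeterministic 1) c ({T} : Language (Fin m)) := hMc
      _ ≤ f (minSize (oneWayDeterministic k) c ({T} : Language (Fin m))) :=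
        hbound m _ ⟨_, hmem⟩ hdesc
      _ ≤ F (c m (D x)) := Finset.single_le_sum (f := f) (fun _ _ => Nat.zero_le _)
        (Finset.mem_range.2 (Nat.lt_succ_of_le hle))
  have hlen := length_lt_of_language_eq_singleton hM1 hM2 hML
  have hpow : 2 ^ M.states ≤ 2 ^ S (F (c m (D x))) :=
    Nat.pow_le_pow_right (by omega) (hstates M ⟨hM1, hM2⟩ _ hMF)
  exact hT.mono (by simp only [B]; omega)
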